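/- \textbf{Theorem ($d$-th-order failure risk estimation).} Let $d\ge 1$ and let $\boldsymbol y\sim\mathcal N(\bar{\boldsymbol y},\boldsymbol\Sigma_y)$ be a Gaussian random vector in $\mathbb R^d$, where $\boldsymbol\Sigma_y$ is a symmetric positive semidefinite covariance matrix with $\sigma_i:=\sqrt{(\boldsymbol\Sigma_y)_{i,i}}>0$ for every $i$ (for instance, $\boldsymbol\Sigma_y$ positive definite). Assume $\bar{\boldsymbol y}\preceq\boldsymbol 0$, that is, $\bar y_i\le 0$ for all $i$. Let $r_i=-\bar y_i/\sigma_i$ be the signed Mahalanobis distances, let $\tilde r_1\le\dots\le\tilde r_d$ be the values $r_1,\dots,r_d$ sorted increasingly, and set $\tilde r_0=0$. Let $\Phi_d$ be the cumulative distribution function of the chi-squared distribution with $d$ degrees of freedom, $\Psi_d(r)=1-\Phi_d(r^2)$ for $r\ge0$ and $\Psi_d(r)=1$ for $r<0$, and $\Delta\Psi_d(R_1,R_2)=\Psi_d(R_1)-\Psi_d(R_2)$. For $d\ge2$ and $x\in[0,1]$ let \[ \mathcal I(x)=I_{1-x^2}\!\left(\tfrac{d-1}{2},\tfrac12\right),\qquad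 I_s(a,b)=\frac{1}{B(a,b)}\int_0^{s}t^{a-1}(1-t)^{b-1}\,dt , \] where $B$ is the Euler beta function. Then \[ \beta_{\mathrm T,d}:=1-\sum_{i=1}^{d}\Delta\Psi_d(\tilde r_{i-1},\tilde r_i)\,\max\!\left[0,\;1-\frac12\sum_{j=1}^{i-1}\mathcal I\!\left(\frac{\tilde r_j}{\tilde r_i}\right)\right]\;\ge\;\beta_{\mathrm R}:=1-\mathbb P(\boldsymbol y\preceq\boldsymbol 0). \] (When $\tilde r_i=0$ the $i$-th term is zero, whatever value is given to the quotients $\tilde r_j/\tilde r_i$. When $d=1$ the inner sum is empty.) -/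

import Mathlib

open MeasureTheory ProbabilityTheory

noncomputable section

namespace FailureRisk

/-- The chi-squared distribution with `d` degrees of freedom: the law of the sum of the squares of
`d` independent standard normal variables. -/
def chiSquared (d : ℕ) : Measure ℝ :=
  (Measure.pi (fun _ : Fin d => gaussianReal 0 1)).map (fun z => ∑ i, z i ^ 2)

/-- `Φ_d`, the cumulative distribution function of the chi-squared distribution. -/
def Phi (d : ℕ) (t : ℝ) : ℝ := cdf (chiSquared d) t

/-- `Ψ_d(r) = 1 - Φ_d(r²)` for `r ≥ 0`, and `Ψ_d(r) = 1` for negative `r`. -/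
def Psi (d : ℕ) (r : ℝ) : ℝ := if 0 ≤ r then 1 - Phi d (r ^ 2) else 1

/-- `ΔΨ_d(R₁, R₂) = Ψ_d(R₁) - Ψ_d(R₂)`. -/
def DeltaPsi (d : ℕ) (R₁ R₂ : ℝ) : ℝ := Psi d R₁ - Psi d R₂

/-- The regularized incomplete beta function `I_x(a, b)`, for `a, b > 0` and `0 ≤ x ≤ 1`;
`ProbabilityTheory.beta` is the Euler beta function. -/
def regIncBeta (x a b : ℝ) : ℝ :=
  1 / beta a b * ∫ t in (0 : ℝ)..x, t ^ (a - 1) * (1 - t) ^ (b - 1)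

/-- `ℐ(x) = I_{1 - x²}((d - 1)/2, 1/2)`. For `d ≥ 2` and `0 ≤ θ ≤ π/2`, `ℐ(cos θ) / 2` is the
fraction of the volume of a `d`-dimensional ball that lies in a spherical sector of half-angle
`θ`. -/
def sectorI (d : ℕ) (x : ℝ) : ℝ := regIncBeta (1 - x ^ 2) (((d : ℝ) - 1) / 2) (1 / 2)

/-- The signed Mahalanobis distances `r_i = -ȳ_i / σ_i`, with `σ_i = √Σ_{i,i}`. -/
def signedDist {d : ℕ} (ybar : EuclideanSpace ℝ (Fin d)) (S : Matrix (Fin d) (Fin d) ℝ)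
    (i : Fin d) : ℝ :=
  -ybar i / Real.sqrt (S i i)

/-- The increasing rearrangement `r̃_1 ≤ ⋯ ≤ r̃_d` of `r`, numbered from `1`, with the convention
`r̃_0 = 0`. (Indices above `d` are never used.) -/
def sorted {d : ℕ} (r : Fin d → ℝ) (i : ℕ) : ℝ :=
  if h : 1 ≤ i ∧ i ≤ d then r (Tuple.sort r ⟨i - 1, by omega⟩) else 0

/-- The `d`-th order failure risk estimation
`β_{T,d} = 1 - ∑_{i=1}^d ΔΨ_d(r̃_{i-1}, r̃_i) max[0, 1 - ½ ∑_{j=1}^{i-1} ℐ(r̃_j / r̃_i)]`. -/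
def betaT {d : ℕ} (r : Fin d → ℝ) : ℝ :=
  1 - ∑ i ∈ Finset.Icc 1 d, DeltaPsi d (sorted r (i - 1)) (sorted r i) *
    max 0 (1 - 1 / 2 * ∑ j ∈ Finset.Ico 1 i, sectorI d (sorted r j / sorted r i))

/-- The real risk `β_R = 1 - ℙ(Y ⪯ 0)`. -/
def realRisk {Ω : Type*} [MeasurableSpace Ω] (P : Measure Ω) {d : ℕ}
    (Y : Ω → EuclideanSpace ℝ (Fin d)) : ℝ :=
  1 - P.real {ω | ∀ i, Y ω i ≤ 0}

end FailureRisk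

end

/-!
Whitening `y = ȳ + √S z` turns `y ⪯ 0` into membership of a standard Gaussian vector `z` in an
intersection of half-spaces at distances `r i` from the origin. Slice space into the spherical
shells bounded by the sorted distances. Inside the shell of outer radius `r̃ k` only the half-spaces
nearer than `r̃ k` cut anything off, and the `j`-th of them cuts off at most the part of the shell
in a cone of half-angle `arccos (r̃ j / r̃ k)`; a union bound over `j` gives the `k`-th term of
`betaT`.

The share of a shell lying in such a cone is `sectorI / 2`: for a unit vector `u`, the quantities
`‖z‖²` and `1 - ⟪u, z⟫² / ‖z‖²` are independent, with laws `χ²(d)` and `Beta((d - 1)/2, 1/2)`,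
since `X + W` and `X / (X + W)` are independent for independent gamma variables `X`, `W` of equal
rate; the factor `1/2` comes from the reflection `z ↦ -z`, which exchanges the cones around `u` and
`-u`.
-/

namespace FailureRisk

open scoped ENNReal MatrixOrder RealInnerProductSpace

section GammaBeta

variable {a b r s t : ℝ}

@[fun_prop]
lemma measurable_gammaPDF (a r : ℝ) : Measurable (gammaPDF a r) :=
  (measurable_gammaPDFReal a r).ennreal_ofReal

@[fun_prop]
lemma measurable_betaPDF (a b : ℝ) : Measurable (betaPDF a b) :=
  (measurable_betaPDFReal a b).ennreal_ofReal

lemma lintegral_gammaMeasure (a r : ℝ) {f : ℝ → ℝ≥0∞} (hf : Measurable f) :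
    ∫⁻ x, f x ∂gammaMeasure a r = ∫⁻ x, gammaPDF a r x * f x :=
  lintegral_withDensity_eq_lintegral_mul _ (measurable_gammaPDF a r) hf

lemma lintegral_betaMeasure (a b : ℝ) {f : ℝ → ℝ≥0∞} (hf : Measurable f) :
    ∫⁻ x, f x ∂betaMeasure a b = ∫⁻ x, betaPDF a b x * f x :=
  lintegral_withDensity_eq_lintegral_mul _ (measurable_betaPDF a b) hf

lemma mul_gammaPDFReal_mul_gammaPDFReal (ha : 0 < a) (hb : 0 < b) (hr : 0 < r) (hs : 0 < s)
    (ht0 : 0 < t) (ht1 : t < 1) :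
    s * (gammaPDFReal a r (s * t) * gammaPDFReal b r (s * (1 - t))) =
      gammaPDFReal (a + b) r s * betaPDFReal a b t := by
  have ht1' : 0 < 1 - t := sub_pos.2 ht1
  have hexp : Real.exp (-(r * s)) =
      Real.exp (-(r * (s * t))) * Real.exp (-(r * (s * (1 - t)))) := by
    rw [← Real.exp_add]; ring_nf
  have hpow : s ^ (a + b - 1) = s * (s ^ (a - 1) * s ^ (b - 1)) := by
    nth_rw 2 [← Real.rpow_one s]
    rw [← Real.rpow_add hs, ← Real.rpow_add hs]
    ring_nf
  have := Real.Gamma_pos_of_pos ha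
  have := Real.Gamma_pos_of_pos hb
  have := Real.Gamma_pos_of_pos (add_pos ha hb)
  rw [gammaPDFReal, gammaPDFReal, gammaPDFReal, betaPDFReal, if_pos (by positivity),
    if_pos (by positivity), if_pos hs.le, if_pos ⟨ht0, ht1⟩, Real.mul_rpow hs.le ht0.le,
    Real.mul_rpow hs.le ht1'.le, hexp, hpow, Real.rpow_add hr, beta]
  field_simp

lemma ofReal_abs_mul_gammaPDF_mul_gammaPDF (ha : 0 < a) (hb : 0 < b) (hr : 0 < r) (hs : s ≠ 0)
    (ht0 : t ≠ 0) (ht1 : t ≠ 1) :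
    ENNReal.ofReal |s| * (gammaPDF a r (s * t) * gammaPDF b r (s * (1 - t))) =
      gammaPDF (a + b) r s * betaPDF a b t := by
  rcases hs.lt_or_gt with hs | hs
  · rcases lt_or_ge 0 t with ht | ht
    · simp [gammaPDF_of_neg hs, gammaPDF_of_neg (mul_neg_of_neg_of_pos hs ht)]
    · have : s * (1 - t) < 0 := mul_neg_of_neg_of_pos hs (by linarith)
      simp [gammaPDF_of_neg hs, gammaPDF_of_neg this]
  rcases ht0.lt_or_gt with ht0 | ht0
  · simp [betaPDF_eq_zero_of_nonpos ht0.le, gammaPDF_of_neg (mul_neg_of_pos_of_neg hs ht0)]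
  rcases ht1.lt_or_gt with ht1 | ht1
  · rw [abs_of_pos hs, gammaPDF, gammaPDF, gammaPDF, betaPDF,
      ← ENNReal.ofReal_mul (gammaPDFReal_nonneg ha hr _), ← ENNReal.ofReal_mul hs.le,
      ← ENNReal.ofReal_mul (gammaPDFReal_nonneg (add_pos ha hb) hr _),
      mul_gammaPDFReal_mul_gammaPDFReal ha hb hr hs ht0 ht1]
  · have : s * (1 - t) < 0 := mul_neg_of_pos_of_neg hs (by linarith)
    simp [betaPDF_eq_zero_of_one_le ht1.le, gammaPDF_of_neg this]

lemma lintegral_eq_ofReal_abs_mul_lintegral_comp_mul_left {c : ℝ} (hc : c ≠ 0) (f : ℝ → ℝ≥0∞) :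
    ∫⁻ x, f x = ENNReal.ofReal |c| * ∫⁻ x, f (c * x) := by
  conv_lhs =>
    rw [← Real.smul_map_volume_mul_left hc, lintegral_smul_measure,
      (measurableEmbedding_mulLeft₀ hc).lintegral_map]
  rfl

lemma lintegral_gammaPDF_mul_gammaPDF_sub (ha : 0 < a) (hb : 0 < b) (hr : 0 < r) (hs : s ≠ 0)
    {f : ℝ → ℝ≥0∞} (hf : Measurable f) :
    ∫⁻ x, gammaPDF a r x * gammaPDF b r (s - x) * f (x / s) =
      gammaPDF (a + b) r s * ∫⁻ t, f t ∂betaMeasure a b := by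
  rw [lintegral_eq_ofReal_abs_mul_lintegral_comp_mul_left hs, lintegral_betaMeasure a b hf,
    ← lintegral_const_mul _ (by fun_prop), ← lintegral_const_mul _ (by fun_prop)]
  refine lintegral_congr_ae ?_
  filter_upwards [Measure.ae_ne volume (0 : ℝ), Measure.ae_ne volume (1 : ℝ)] with t ht0 ht1
  rw [mul_div_cancel_left₀ _ hs, ← mul_one_sub, ← mul_assoc,
    ofReal_abs_mul_gammaPDF_mul_gammaPDF ha hb hr hs ht0 ht1, mul_assoc]

theorem map_add_div_gammaMeasure_prod (ha : 0 < a) (hb : 0 < b) (hr : 0 < r) :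
    ((gammaMeasure a r).prod (gammaMeasure b r)).map (fun p => (p.1 + p.2, p.1 / (p.1 + p.2))) =
      (gammaMeasure (a + b) r).prod (betaMeasure a b) := by
  have := isProbabilityMeasure_gammaMeasure ha hr
  have := isProbabilityMeasure_gammaMeasure hb hr
  have := isProbabilityMeasureBeta ha hb
  refine Measure.ext_of_lintegral _ fun f hf => ?_
  rw [lintegral_map hf (by fun_prop), lintegral_prod _ (by fun_prop),
    lintegral_prod _ (by fun_prop),
    lintegral_gammaMeasure a r (Measurable.lintegral_prod_right'
      (f := fun p : ℝ × ℝ => f (p.1 + p.2, p.1 / (p.1 + p.2))) (by fun_prop)),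
    lintegral_gammaMeasure (a + b) r (Measurable.lintegral_prod_right' hf)]
  -- substitute `s = x + y`, exchange the integrals, then substitute `x = s * t`
  calc ∫⁻ x, gammaPDF a r x * ∫⁻ y, f (x + y, x / (x + y)) ∂gammaMeasure b r
      = ∫⁻ x, ∫⁻ s, gammaPDF a r x * gammaPDF b r (s - x) * f (s, x / s) := by
        refine lintegral_congr fun x => ?_
        rw [lintegral_gammaMeasure b r (by fun_prop), ← lintegral_const_mul _ (by fun_prop),
          ← lintegral_sub_right_eq_self (μ := volume) _ x]
        simp only [add_sub_cancel, mul_assoc]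
    _ = ∫⁻ s, ∫⁻ x, gammaPDF a r x * gammaPDF b r (s - x) * f (s, x / s) :=
        lintegral_lintegral_swap (Measurable.aemeasurable (by fun_prop))
    _ = ∫⁻ s, gammaPDF (a + b) r s * ∫⁻ t, f (s, t) ∂betaMeasure a b := by
        refine lintegral_congr_ae ?_
        filter_upwards [Measure.ae_ne volume (0 : ℝ)] with s hs
        exact lintegral_gammaPDF_mul_gammaPDF_sub ha hb hr hs (f := fun t => f (s, t))
          (by fun_prop)

lemma gammaMeasure_conv_gammaMeasure (ha : 0 < a) (hb : 0 < b) (hr : 0 < r) :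
    gammaMeasure a r ∗ gammaMeasure b r = gammaMeasure (a + b) r := by
  have := isProbabilityMeasureBeta ha hb
  have h := congrArg (Measure.map Prod.fst) (map_add_div_gammaMeasure_prod ha hb hr)
  rw [Measure.map_map (by fun_prop) (by fun_prop), Measure.map_fst_prod, measure_univ,
    one_smul] at h
  exact h

lemma betaPDFReal_nonneg (ha : 0 < a) (hb : 0 < b) (t : ℝ) : 0 ≤ betaPDFReal a b t := by
  by_cases h : 0 < t ∧ t < 1
  · exact (betaPDFReal_pos h.1 h.2 ha hb).le
  · rw [betaPDFReal, if_neg h]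

lemma betaMeasure_real_Iio {x : ℝ} (ha : 0 < a) (hb : 0 < b) (hx0 : 0 ≤ x) (hx1 : x ≤ 1) :
    (betaMeasure a b).real (Set.Iio x) = regIncBeta x a b := by
  calc (betaMeasure a b).real (Set.Iio x)
      = ∫ t in Set.Iio x, betaPDFReal a b t := by
        rw [betaMeasure, measureReal_def, withDensity_apply _ measurableSet_Iio]
        exact (integral_eq_lintegral_of_nonneg_ae (ae_of_all _ (betaPDFReal_nonneg ha hb))
          (by fun_prop)).symm
    _ = ∫ t in Set.Ioo 0 x, betaPDFReal a b t :=
        setIntegral_eq_of_subset_of_forall_sdiff_eq_zero measurableSet_Iio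
          Set.Ioo_subset_Iio_self fun t ht => if_neg fun h => ht.2 ⟨h.1, ht.1⟩
    _ = ∫ t in Set.Ioo 0 x, 1 / beta a b * (t ^ (a - 1) * (1 - t) ^ (b - 1)) :=
        setIntegral_congr_fun measurableSet_Ioo fun t ht => by
          rw [betaPDFReal, if_pos ⟨ht.1, ht.2.trans_le hx1⟩, mul_assoc]
    _ = regIncBeta x a b := by
        rw [regIncBeta, integral_const_mul, intervalIntegral.integral_of_le hx0,
          integral_Ioc_eq_integral_Ioo]

end GammaBeta

section ChiSquared

lemma lintegral_eq_two_mul_setLIntegral_Ioi_of_even {f : ℝ → ℝ≥0∞} (hf : ∀ x, f (-x) = f x) :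
    ∫⁻ x, f x = 2 * ∫⁻ x in Set.Ioi 0, f x := by
  have hneg : ∫⁻ x in Set.Iio 0, f x = ∫⁻ x in Set.Ioi 0, f x := by
    rw [← (Measure.measurePreserving_neg (volume : Measure ℝ)).setLIntegral_comp_preimage_emb
      (MeasurableEquiv.neg ℝ).measurableEmbedding]
    simp [hf]
  rw [← lintegral_add_compl f measurableSet_Iio, Set.compl_Iio,
    setLIntegral_congr Ioi_ae_eq_Ici.symm, hneg, two_mul]

lemma setLIntegral_Ioi_eq_setLIntegral_comp_sq (f : ℝ → ℝ≥0∞) :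
    ∫⁻ y in Set.Ioi 0, f y = ∫⁻ x in Set.Ioi 0, ENNReal.ofReal (2 * x) * f (x ^ 2) := by
  have himage : (fun x : ℝ => x ^ 2) '' Set.Ioi 0 = Set.Ioi 0 :=
    Set.Subset.antisymm (Set.image_subset_iff.2 fun x hx => pow_pos (Set.mem_Ioi.1 hx) 2)
      fun y hy => ⟨√y, Real.sqrt_pos.2 hy, Real.sq_sqrt (le_of_lt hy)⟩
  conv_lhs => rw [← himage]
  exact lintegral_image_eq_lintegral_deriv_mul_of_monotoneOn measurableSet_Ioi
    (fun x _ => by simpa using (hasDerivAt_pow 2 x).hasDerivWithinAt)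
    (fun x hx _ _ hxy => pow_le_pow_left₀ (le_of_lt hx) hxy 2) f

lemma two_mul_gaussianPDF {x : ℝ} (hx : 0 < x) :
    2 * gaussianPDF 0 1 x = ENNReal.ofReal (2 * x) * gammaPDF (1 / 2) (1 / 2) (x ^ 2) := by
  rw [gammaPDF_of_nonneg (by positivity), gaussianPDF, gaussianPDFReal,
    ← ENNReal.ofReal_mul (by positivity), ← ENNReal.ofReal_ofNat,
    ← ENNReal.ofReal_mul (by positivity)]
  congr 1
  rw [← Real.rpow_natCast x 2, ← Real.rpow_mul hx.le, Real.Gamma_one_half_eq,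
    ← Real.sqrt_eq_rpow (1 / 2)]
  norm_num [Real.rpow_neg_one]
  field_simp

theorem map_sq_gaussianReal :
    (gaussianReal 0 1).map (fun x => x ^ 2) = gammaMeasure (1 / 2) (1 / 2) := by
  refine Measure.ext_of_lintegral _ fun f hf => ?_
  calc ∫⁻ y, f y ∂(gaussianReal 0 1).map (fun x => x ^ 2)
      = ∫⁻ x, gaussianPDF 0 1 x * f (x ^ 2) := by
        rw [lintegral_map hf (by fun_prop), gaussianReal_of_var_ne_zero _ one_ne_zero]
        exact lintegral_withDensity_eq_lintegral_mul _ (by fun_prop) (by fun_prop)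
    _ = ∫⁻ x in Set.Ioi 0, 2 * (gaussianPDF 0 1 x * f (x ^ 2)) := by
        rw [lintegral_const_mul _ (by fun_prop)]
        exact lintegral_eq_two_mul_setLIntegral_Ioi_of_even fun x => by
          simp [gaussianPDF, gaussianPDFReal]
    _ = ∫⁻ x in Set.Ioi 0, ENNReal.ofReal (2 * x) *
          (gammaPDF (1 / 2) (1 / 2) (x ^ 2) * f (x ^ 2)) :=
        setLIntegral_congr_fun measurableSet_Ioi fun x hx => by
          rw [← mul_assoc, two_mul_gaussianPDF hx, mul_assoc]
    _ = ∫⁻ y in Set.Ioi 0, gammaPDF (1 / 2) (1 / 2) y * f y :=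
        (setLIntegral_Ioi_eq_setLIntegral_comp_sq fun y => gammaPDF (1 / 2) (1 / 2) y * f y).symm
    _ = ∫⁻ y in Set.Ici 0, gammaPDF (1 / 2) (1 / 2) y * f y := setLIntegral_congr Ioi_ae_eq_Ici
    _ = ∫⁻ y, gammaPDF (1 / 2) (1 / 2) y * f y :=
        setLIntegral_eq_of_support_subset fun y hy =>
          Set.mem_Ici.2 (not_lt.1 fun hy0 => hy (by simp [gammaPDF_of_neg hy0]))
    _ = ∫⁻ y, f y ∂gammaMeasure (1 / 2) (1 / 2) := (lintegral_gammaMeasure _ _ hf).symm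

instance isProbabilityMeasure_chiSquared (d : ℕ) : IsProbabilityMeasure (chiSquared d) :=
  Measure.isProbabilityMeasure_map (Measurable.aemeasurable (by fun_prop))

lemma map_sum_sq_castSucc_sq_last (n : ℕ) :
    (Measure.pi fun _ : Fin (n + 1) => gaussianReal 0 1).map
      (fun z => (∑ i : Fin n, z i.castSucc ^ 2, z (Fin.last n) ^ 2)) =
    (chiSquared n).prod (gammaMeasure (1 / 2) (1 / 2)) := by
  have h := (measurePreserving_piFinSuccAbove (fun _ : Fin (n + 1) => gaussianReal 0 1)
    (Fin.last n)).map_eq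
  rw [← map_sq_gaussianReal, chiSquared, Measure.map_prod_map _ _ (by fun_prop) (by fun_prop),
    ← Measure.prod_swap, ← h, Measure.map_map (by fun_prop) (by fun_prop),
    Measure.map_map (by fun_prop) (by fun_prop)]
  congr 1
  ext z <;> simp [Fin.init]

lemma chiSquared_succ (n : ℕ) :
    chiSquared (n + 1) = chiSquared n ∗ gammaMeasure (1 / 2) (1 / 2) := by
  rw [Measure.conv, ← map_sum_sq_castSucc_sq_last, Measure.map_map (by fun_prop) (by fun_prop),
    chiSquared]
  simp only [Fin.sum_univ_castSucc, Function.comp_def]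

theorem chiSquared_eq_gammaMeasure {d : ℕ} (hd : 1 ≤ d) :
    chiSquared d = gammaMeasure (d / 2) (1 / 2) := by
  induction d, hd using Nat.le_induction with
  | base =>
    have := isProbabilityMeasure_gammaMeasure (a := 1 / 2) (r := 1 / 2) (by simp) (by simp)
    have h0 : chiSquared 0 = Measure.dirac 0 := by simp [chiSquared, Measure.map_const]
    have h1 : chiSquared 1 = chiSquared 0 ∗ gammaMeasure (1 / 2) (1 / 2) := chiSquared_succ 0
    rw [h1, h0, Measure.dirac_zero_conv, Nat.cast_one]
  | succ n hn ih =>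
    rw [chiSquared_succ, ih, gammaMeasure_conv_gammaMeasure (by positivity) (by simp) (by simp)]
    push_cast
    ring_nf

theorem map_sum_sq_div_sum_sq {n : ℕ} (hn : 1 ≤ n) :
    (Measure.pi fun _ : Fin (n + 1) => gaussianReal 0 1).map
      (fun z => (∑ i, z i ^ 2, (∑ i : Fin n, z i.castSucc ^ 2) / ∑ i, z i ^ 2)) =
    (chiSquared (n + 1)).prod (betaMeasure (n / 2) (1 / 2)) := by
  have h := map_add_div_gammaMeasure_prod (a := (n : ℝ) / 2) (b := 1 / 2) (r := 1 / 2)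
    (by positivity) (by simp) (by simp)
  rw [← chiSquared_eq_gammaMeasure hn, ← map_sum_sq_castSucc_sq_last,
    Measure.map_map (by fun_prop) (by fun_prop)] at h
  rw [chiSquared_eq_gammaMeasure (Nat.le_add_left 1 n), Nat.cast_add_one, add_div, ← h]
  simp only [Fin.sum_univ_castSucc, Function.comp_def]

end ChiSquared


section Cones

variable {E : Type*} [NormedAddCommGroup E]

/-- The points whose distance to the origin lies in `(R₁, R₂]`; half-open, so that consecutive
shells are disjoint. -/
def shell (E : Type*) [NormedAddCommGroup E] (R₁ R₂ : ℝ) : Set E := {z | ‖z‖ ∈ Set.Ioc R₁ R₂}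

lemma measurableSet_shell [MeasurableSpace E] [OpensMeasurableSpace E] (R₁ R₂ : ℝ) :
    MeasurableSet (shell E R₁ R₂) :=
  measurable_norm measurableSet_Ioc

lemma shell_eq_preimage_norm_sq {R₁ R₂ : ℝ} (h₁ : 0 ≤ R₁) (h₂ : R₁ ≤ R₂) :
    shell E R₁ R₂ = (fun z => ‖z‖ ^ 2) ⁻¹' Set.Ioc (R₁ ^ 2) (R₂ ^ 2) := by
  ext z
  simp only [shell, Set.mem_ofPred_eq, Set.mem_preimage, Set.mem_Ioc,
    pow_lt_pow_iff_left₀ h₁ (norm_nonneg z) two_ne_zero,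
    pow_le_pow_iff_left₀ (norm_nonneg z) (h₁.trans h₂) two_ne_zero]

variable [InnerProductSpace ℝ E]

/-- The open circular cone around the unit vector `u` of half-angle `arccos c`. -/
def cone (u : E) (c : ℝ) : Set E := {z | c * ‖z‖ < ⟪u, z⟫}

lemma measurableSet_cone [MeasurableSpace E] [OpensMeasurableSpace E] (u : E) (c : ℝ) :
    MeasurableSet (cone u c) :=
  (isOpen_lt (by fun_prop) (by fun_prop)).measurableSet

lemma neg_cone (u : E) (c : ℝ) : -cone u c = cone (-u) c := by
  ext z
  simp [cone]

lemma disjoint_cone_cone_neg (u : E) {c : ℝ} (hc : 0 ≤ c) : Disjoint (cone u c) (cone (-u) c) := by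
  refine Set.disjoint_left.2 fun z (h : c * ‖z‖ < ⟪u, z⟫) (h' : c * ‖z‖ < ⟪-u, z⟫) => ?_
  have : 0 ≤ c * ‖z‖ := by positivity
  rw [inner_neg_left] at h'
  linarith

lemma cone_union_cone_neg_subset (u : E) {c : ℝ} (hc : 0 ≤ c) :
    cone u c ∪ cone (-u) c ⊆ {z | c ^ 2 * ‖z‖ ^ 2 < ⟪u, z⟫ ^ 2} := by
  rintro z (h | h) <;> rw [Set.mem_ofPred_eq, ← mul_pow]
  · exact pow_lt_pow_left₀ h (by positivity) two_ne_zero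
  · rw [← neg_sq ⟪u, z⟫, ← inner_neg_left]
    exact pow_lt_pow_left₀ h (by positivity) two_ne_zero

end Cones

section GaussianCones

lemma exists_orthonormalBasis_apply_eq {𝕜 ι F : Type*} [RCLike 𝕜] [Fintype ι]
    [NormedAddCommGroup F] [InnerProductSpace 𝕜 F] [FiniteDimensional 𝕜 F]
    (hι : Module.finrank 𝕜 F = Fintype.card ι) (i : ι) {u : F} (hu : ‖u‖ = 1) :
    ∃ b : OrthonormalBasis ι 𝕜 F, b i = u := by
  have hsingle : Orthonormal 𝕜 (Set.domRestrict {i} fun _ => u) :=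
    ⟨fun _ => hu, fun j k hjk => (hjk (Subsingleton.elim j k)).elim⟩
  obtain ⟨b, hb⟩ := hsingle.exists_orthonormalBasis_extension_of_card_eq hι
  exact ⟨b, hb i rfl⟩

variable {E : Type*} [NormedAddCommGroup E] [InnerProductSpace ℝ E] [FiniteDimensional ℝ E]
  [MeasurableSpace E] [BorelSpace E]

theorem map_norm_sq_share_stdGaussian {u : E} (hu : ‖u‖ = 1) (hE : 1 < Module.finrank ℝ E) :
    (stdGaussian E).map (fun z => (‖z‖ ^ 2, (‖z‖ ^ 2 - ⟪u, z⟫ ^ 2) / ‖z‖ ^ 2)) =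
      (chiSquared (Module.finrank ℝ E)).prod
        (betaMeasure (((Module.finrank ℝ E : ℝ) - 1) / 2) (1 / 2)) := by
  obtain ⟨n, hn⟩ := Nat.exists_eq_add_of_lt hE
  have hdim : Module.finrank ℝ E = 1 + n + 1 := hn
  obtain ⟨b, rfl⟩ := exists_orthonormalBasis_apply_eq (𝕜 := ℝ) (ι := Fin (1 + n + 1))
    (by rw [hdim, Fintype.card_fin]) (Fin.last _) hu
  have hnorm (x : Fin (1 + n + 1) → ℝ) : ‖∑ i, x i • b i‖ ^ 2 = ∑ i, x i ^ 2 := by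
    rw [← b.sum_sq_inner_right]
    simp [b.orthonormal.inner_right_fintype]
  have hinner (x : Fin (1 + n + 1) → ℝ) : ⟪b (Fin.last _), ∑ i, x i • b i⟫ = x (Fin.last _) := by
    simp [b.orthonormal.inner_right_fintype]
  rw [stdGaussian_eq_map_pi_orthonormalBasis b, Measure.map_map (by fun_prop) (by fun_prop), hdim,
    Nat.cast_add_one, add_sub_cancel_right, ← map_sum_sq_div_sum_sq (Nat.le_add_right 1 n)]
  congr 1
  ext x <;> simp only [Function.comp_apply, hnorm, hinner]
  rw [Fin.sum_univ_castSucc, add_sub_cancel_right]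

theorem map_norm_sq_stdGaussian :
    (stdGaussian E).map (fun z => ‖z‖ ^ 2) = chiSquared (Module.finrank ℝ E) := by
  rw [stdGaussian_eq_map_pi_orthonormalBasis (stdOrthonormalBasis ℝ E),
    Measure.map_map (by fun_prop) (by fun_prop), chiSquared]
  congr 1
  ext x
  rw [Function.comp_apply, ← (stdOrthonormalBasis ℝ E).sum_sq_inner_right]
  simp [(stdOrthonormalBasis ℝ E).orthonormal.inner_right_fintype]

lemma sectorI_eq_betaMeasure_real_Iio {d : ℕ} (hd : 1 < d) {c : ℝ} (hc : c ^ 2 ≤ 1) :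
    sectorI d c = (betaMeasure (((d : ℝ) - 1) / 2) (1 / 2)).real (Set.Iio (1 - c ^ 2)) := by
  have hd' : (1 : ℝ) < d := mod_cast hd
  rw [sectorI, betaMeasure_real_Iio (by linarith) (by simp) (by linarith)
    (by linarith [sq_nonneg c])]

lemma stdGaussian_real_double_cone_le {u : E} (hu : ‖u‖ = 1) (hE : 1 < Module.finrank ℝ E)
    {c : ℝ} (hc : c ^ 2 ≤ 1) {B : Set ℝ} (hB : MeasurableSet B) :
    (stdGaussian E).real ({z | c ^ 2 * ‖z‖ ^ 2 < ⟪u, z⟫ ^ 2} ∩ (fun z => ‖z‖ ^ 2) ⁻¹' B) ≤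
      (chiSquared (Module.finrank ℝ E)).real B * sectorI (Module.finrank ℝ E) c := by
  have hE' : (1 : ℝ) < Module.finrank ℝ E := mod_cast hE
  have := isProbabilityMeasureBeta (α := ((Module.finrank ℝ E : ℝ) - 1) / 2) (β := 1 / 2)
    (by linarith) (by simp)
  rw [sectorI_eq_betaMeasure_real_Iio hE hc, ← measureReal_prod_prod,
    ← map_norm_sq_share_stdGaussian hu hE,
    map_measureReal_apply (by fun_prop) (hB.prod measurableSet_Iio)]
  refine measureReal_mono fun z ⟨hz, hzB⟩ => ⟨hzB, ?_⟩
  have hz : c ^ 2 * ‖z‖ ^ 2 < ⟪u, z⟫ ^ 2 := hz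
  have hz0 : z ≠ 0 := by
    rintro rfl
    simp at hz
  rw [Set.mem_Iio, div_lt_iff₀ (by positivity)]
  linarith

lemma stdGaussian_real_neg {s : Set E} (hs : MeasurableSet s) :
    (stdGaussian E).real (-s) = (stdGaussian E).real s := by
  conv_rhs => rw [← stdGaussian_map (LinearIsometryEquiv.neg ℝ (E := E)),
    map_measureReal_apply (by fun_prop) hs]
  rfl

lemma stdGaussian_real_cone_inter_le {u : E} (hu : ‖u‖ = 1) (hE : 1 < Module.finrank ℝ E)
    {c : ℝ} (hc0 : 0 ≤ c) (hc1 : c ≤ 1) {B : Set ℝ} (hB : MeasurableSet B) :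
    (stdGaussian E).real (cone u c ∩ (fun z => ‖z‖ ^ 2) ⁻¹' B) ≤
      (chiSquared (Module.finrank ℝ E)).real B * (1 / 2 * sectorI (Module.finrank ℝ E) c) := by
  have hB' : MeasurableSet ((fun z : E => ‖z‖ ^ 2) ⁻¹' B) := hB.preimage (by fun_prop)
  have hneg : (stdGaussian E).real (cone (-u) c ∩ (fun z => ‖z‖ ^ 2) ⁻¹' B) =
      (stdGaussian E).real (cone u c ∩ (fun z => ‖z‖ ^ 2) ⁻¹' B) := by
    rw [← stdGaussian_real_neg ((measurableSet_cone u c).inter hB'), Set.inter_neg,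
      neg_cone]
    simp [← Set.neg_preimage, Set.preimage_preimage]
  have hunion := measureReal_union (μ := stdGaussian E)
    ((disjoint_cone_cone_neg u hc0).mono Set.inter_subset_left Set.inter_subset_left)
    ((measurableSet_cone (-u) c).inter hB') (s₁ := cone u c ∩ (fun z => ‖z‖ ^ 2) ⁻¹' B)
  have hle : (stdGaussian E).real ((cone u c ∩ (fun z => ‖z‖ ^ 2) ⁻¹' B) ∪
      (cone (-u) c ∩ (fun z => ‖z‖ ^ 2) ⁻¹' B)) ≤
      (chiSquared (Module.finrank ℝ E)).real B * sectorI (Module.finrank ℝ E) c := by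
    rw [← Set.union_inter_distrib_right]
    exact (measureReal_mono
      (Set.inter_subset_inter_left _ (cone_union_cone_neg_subset u hc0))).trans
      (stdGaussian_real_double_cone_le hu hE (pow_le_one₀ hc0 hc1) hB)
  linarith

lemma DeltaPsi_eq_chiSquared_real_Ioc (d : ℕ) {R₁ R₂ : ℝ} (h₁ : 0 ≤ R₁) (h₂ : R₁ ≤ R₂) :
    DeltaPsi d R₁ R₂ = (chiSquared d).real (Set.Ioc (R₁ ^ 2) (R₂ ^ 2)) := by
  have hsq : R₁ ^ 2 ≤ R₂ ^ 2 := by gcongr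
  rw [DeltaPsi, Psi, Psi, if_pos h₁, if_pos (h₁.trans h₂), Phi, Phi, cdf_eq_real, cdf_eq_real,
    ← Set.Iic_sdiff_Iic, measureReal_sdiff (Set.Iic_subset_Iic.2 hsq) measurableSet_Iic]
  ring

lemma stdGaussian_real_shell {R₁ R₂ : ℝ} (h₁ : 0 ≤ R₁) (h₂ : R₁ ≤ R₂) :
    (stdGaussian E).real (shell E R₁ R₂) = DeltaPsi (Module.finrank ℝ E) R₁ R₂ := by
  rw [DeltaPsi_eq_chiSquared_real_Ioc _ h₁ h₂, ← map_norm_sq_stdGaussian,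
    map_measureReal_apply (by fun_prop) measurableSet_Ioc, shell_eq_preimage_norm_sq h₁ h₂]

theorem stdGaussian_real_cone_inter_shell_le {u : E} (hu : ‖u‖ = 1)
    (hE : 1 < Module.finrank ℝ E) {c : ℝ} (hc0 : 0 ≤ c) (hc1 : c ≤ 1) {R₁ R₂ : ℝ} (h₁ : 0 ≤ R₁)
    (h₂ : R₁ ≤ R₂) :
    (stdGaussian E).real (cone u c ∩ shell E R₁ R₂) ≤
      DeltaPsi (Module.finrank ℝ E) R₁ R₂ * (1 / 2 * sectorI (Module.finrank ℝ E) c) := by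
  rw [shell_eq_preimage_norm_sq h₁ h₂, DeltaPsi_eq_chiSquared_real_Ioc _ h₁ h₂]
  exact stdGaussian_real_cone_inter_le hu hE hc0 hc1 measurableSet_Ioc

end GaussianCones

section Polyhedron

/-- The intersection of the half-spaces with outer unit normals `u i` at signed distances `r i`
from the origin. -/
def polyhedron {ι E : Type*} [NormedAddCommGroup E] [InnerProductSpace ℝ E] (u : ι → E)
    (r : ι → ℝ) : Set E := {z | ∀ i, ⟪u i, z⟫ ≤ r i}

variable {ι κ E : Type*} [NormedAddCommGroup E] [InnerProductSpace ℝ E]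

lemma polyhedron_comp_equiv (σ : κ ≃ ι) (u : ι → E) (r : ι → ℝ) :
    polyhedron (u ∘ σ) (r ∘ σ) = polyhedron u r :=
  Set.ext fun z => σ.forall_congr_left.trans (by simp [polyhedron])

lemma measurableSet_polyhedron [MeasurableSpace E] [OpensMeasurableSpace E] (u : ι → E)
    (r : ι → ℝ) : MeasurableSet (polyhedron u r) := by
  simp only [polyhedron, Set.ofPred_forall]
  exact (isClosed_iInter fun i => isClosed_le (by fun_prop) (by fun_prop)).measurableSet

lemma mem_cone_of_lt_inner {u z : E} {ρ R₁ R₂ : ℝ} (hρ : 0 ≤ ρ) (hz : z ∈ shell E R₁ R₂)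
    (h : ρ < ⟪u, z⟫) : z ∈ cone u (ρ / R₂) := by
  have hR₂ : 0 ≤ R₂ := (norm_nonneg z).trans hz.2
  calc ρ / R₂ * ‖z‖ = ρ * ‖z‖ / R₂ := div_mul_eq_mul_div _ _ _
    _ ≤ ρ := div_le_of_le_mul₀ hR₂ hρ (mul_le_mul_of_nonneg_left hz.2 hρ)
    _ < ⟪u, z⟫ := h

lemma shell_subset_polyhedron_union_cones {u : ι → E} (hu : ∀ i, ‖u i‖ = 1) {r : ι → ℝ}
    (J : Finset ι) {R₁ R₂ : ℝ} (hnear : ∀ j ∈ J, 0 ≤ r j) (hfar : ∀ i ∉ J, R₂ ≤ r i) :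
    shell E R₁ R₂ ⊆ (polyhedron u r ∩ shell E R₁ R₂) ∪
      ⋃ j ∈ J, cone (u j) (r j / R₂) ∩ shell E R₁ R₂ := by
  intro z hz
  by_cases hP : z ∈ polyhedron u r
  · exact Or.inl ⟨hP, hz⟩
  obtain ⟨i, hi⟩ : ∃ i, r i < ⟪u i, z⟫ := by simpa [polyhedron] using hP
  have hiJ : i ∈ J := by
    by_contra hiJ
    have hinner : ⟪u i, z⟫ ≤ ‖z‖ := by simpa [hu] using real_inner_le_norm (u i) z
    exact absurd ((hfar i hiJ).trans_lt hi) (not_lt.2 (hinner.trans hz.2))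
  exact Or.inr (Set.mem_biUnion hiJ ⟨mem_cone_of_lt_inner (hnear i hiJ) hz hi, hz⟩)

variable [FiniteDimensional ℝ E] [MeasurableSpace E] [BorelSpace E]

theorem DeltaPsi_mul_max_le_stdGaussian_real {u : ι → E} (hu : ∀ i, ‖u i‖ = 1) {r : ι → ℝ}
    (J : Finset ι) (hJ : J.Nonempty → 1 < Module.finrank ℝ E) {R₁ R₂ : ℝ} (h₁ : 0 ≤ R₁)
    (h₂ : R₁ ≤ R₂) (hnear : ∀ j ∈ J, 0 ≤ r j ∧ r j ≤ R₂) (hfar : ∀ i ∉ J, R₂ ≤ r i) :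
    DeltaPsi (Module.finrank ℝ E) R₁ R₂ *
        max 0 (1 - 1 / 2 * ∑ j ∈ J, sectorI (Module.finrank ℝ E) (r j / R₂)) ≤
      (stdGaussian E).real (polyhedron u r ∩ shell E R₁ R₂) := by
  have hΔ : 0 ≤ DeltaPsi (Module.finrank ℝ E) R₁ R₂ := by
    rw [← stdGaussian_real_shell h₁ h₂]
    exact measureReal_nonneg
  rw [mul_max_of_nonneg _ _ hΔ, mul_zero]
  refine max_le measureReal_nonneg ?_
  have hcones : (stdGaussian E).real (⋃ j ∈ J, cone (u j) (r j / R₂) ∩ shell E R₁ R₂) ≤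
      DeltaPsi (Module.finrank ℝ E) R₁ R₂ *
        (1 / 2 * ∑ j ∈ J, sectorI (Module.finrank ℝ E) (r j / R₂)) := by
    rw [Finset.mul_sum, Finset.mul_sum]
    refine (measureReal_biUnion_finset_le _ _).trans (Finset.sum_le_sum fun j hj => ?_)
    have hR₂ : 0 ≤ R₂ := h₁.trans h₂
    exact stdGaussian_real_cone_inter_shell_le (hu j) (hJ ⟨j, hj⟩)
      (div_nonneg (hnear j hj).1 hR₂) (div_le_one_of_le₀ (hnear j hj).2 hR₂) h₁ h₂
  have hcover := (measureReal_mono (μ := stdGaussian E) (shell_subset_polyhedron_union_cones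
    hu J (R₁ := R₁) (fun j hj => (hnear j hj).1) hfar)).trans (measureReal_union_le _ _)
  rw [stdGaussian_real_shell h₁ h₂] at hcover
  linarith

end Polyhedron

section Sorted

variable {d : ℕ} {r : Fin d → ℝ}

lemma sorted_val_add_one (r : Fin d → ℝ) (q : Fin d) :
    sorted r (q + 1) = r (Tuple.sort r q) :=
  dif_pos ⟨Nat.le_add_left 1 q, q.2⟩

lemma sorted_nonneg (hr : ∀ i, 0 ≤ r i) (k : ℕ) : 0 ≤ sorted r k := by
  rw [sorted]
  split_ifs
  · exact hr _
  · exact le_rfl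

lemma sorted_le_sorted (hr : ∀ i, 0 ≤ r i) {j k : ℕ} (hjk : j ≤ k) (hk : k ≤ d) :
    sorted r j ≤ sorted r k := by
  rcases Nat.eq_zero_or_pos j with rfl | hj
  · simpa [sorted] using sorted_nonneg hr k
  · rw [sorted, sorted, dif_pos ⟨hj, hjk.trans hk⟩, dif_pos ⟨hj.trans_le hjk, hk⟩]
    exact Tuple.monotone_sort r (Fin.mk_le_mk.2 (Nat.sub_le_sub_right hjk 1))

lemma sum_filter_val_add_one_lt {M : Type*} [AddCommMonoid M] (f : ℕ → M) {k : ℕ} (hk : k ≤ d) :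
    ∑ q : Fin d with q.val + 1 < k, f (q + 1) = ∑ j ∈ Finset.Ico 1 k, f j := by
  refine Finset.sum_nbij (fun q => q.val + 1) (fun q hq => ?_) (fun p _ q _ h => ?_)
    (fun j hj => ?_) fun q _ => rfl
  · simpa using hq
  · exact Fin.ext (Nat.succ_injective h)
  · obtain ⟨hj1, hjk⟩ := Finset.mem_Ico.1 hj
    exact ⟨⟨j - 1, by omega⟩, by simp; omega, Nat.sub_add_cancel hj1⟩

lemma pairwiseDisjoint_shell_sorted {E : Type*} [NormedAddCommGroup E] (hr : ∀ i, 0 ≤ r i) :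
    (Finset.Icc 1 d : Set ℕ).PairwiseDisjoint
      fun k => shell E (sorted r (k - 1)) (sorted r k) := by
  intro i hi j hj hij
  wlog h : i < j generalizing i j
  · exact (this hj hi hij.symm (hij.symm.lt_of_le (not_lt.1 h))).symm
  rw [Finset.coe_Icc, Set.mem_Icc] at hj
  have hle : sorted r i ≤ sorted r (j - 1) := sorted_le_sorted hr (by omega) (by omega)
  exact Set.disjoint_left.2 fun z hz hz' => (hz.2.trans hle).not_gt hz'.1

variable {E : Type*} [NormedAddCommGroup E] [InnerProductSpace ℝ E] [FiniteDimensional ℝ E]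
  [MeasurableSpace E] [BorelSpace E]

lemma DeltaPsi_sorted_mul_max_le (hE : Module.finrank ℝ E = d) {u : Fin d → E}
    (hu : ∀ i, ‖u i‖ = 1) (hr : ∀ i, 0 ≤ r i) {k : ℕ} (hk : k ≤ d) :
    DeltaPsi d (sorted r (k - 1)) (sorted r k) *
        max 0 (1 - 1 / 2 * ∑ j ∈ Finset.Ico 1 k, sectorI d (sorted r j / sorted r k)) ≤
      (stdGaussian E).real (polyhedron u r ∩ shell E (sorted r (k - 1)) (sorted r k)) := by
  rw [← sum_filter_val_add_one_lt _ hk, ← polyhedron_comp_equiv (Tuple.sort r)]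
  simp only [sorted_val_add_one, ← hE]
  refine DeltaPsi_mul_max_le_stdGaussian_real (r := r ∘ Tuple.sort r) (fun q => hu _) _ ?_
    (sorted_nonneg hr _) (sorted_le_sorted hr (Nat.sub_le k 1) hk) ?_ ?_
  · rintro ⟨q, hq⟩
    have := (Finset.mem_filter.1 hq).2
    omega
  · intro q hq
    rw [Function.comp_apply, ← sorted_val_add_one r]
    exact ⟨sorted_nonneg hr _, sorted_le_sorted hr (Finset.mem_filter.1 hq).2.le hk⟩
  · intro q hq
    rw [Function.comp_apply, ← sorted_val_add_one r]
    exact sorted_le_sorted hr (by simpa using hq) q.2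

theorem one_sub_betaT_le (hE : Module.finrank ℝ E = d) {u : Fin d → E} (hu : ∀ i, ‖u i‖ = 1)
    (hr : ∀ i, 0 ≤ r i) : 1 - betaT r ≤ (stdGaussian E).real (polyhedron u r) := by
  rw [betaT, sub_sub_cancel]
  calc _ ≤ ∑ k ∈ Finset.Icc 1 d,
        (stdGaussian E).real (polyhedron u r ∩ shell E (sorted r (k - 1)) (sorted r k)) :=
        Finset.sum_le_sum fun k hk =>
          DeltaPsi_sorted_mul_max_le hE hu hr (Finset.mem_Icc.1 hk).2
    _ = (stdGaussian E).real (⋃ k ∈ Finset.Icc 1 d,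
          polyhedron u r ∩ shell E (sorted r (k - 1)) (sorted r k)) :=
        (measureReal_biUnion_finset
          ((pairwiseDisjoint_shell_sorted hr).mono fun _ => Set.inter_subset_right)
          fun _ _ => (measurableSet_polyhedron u r).inter (measurableSet_shell _ _)).symm
    _ ≤ (stdGaussian E).real (polyhedron u r) :=
        measureReal_mono (Set.iUnion₂_subset fun _ _ => Set.inter_subset_left)

end Sorted

section Whitening

variable {d : ℕ}

/-- The rows of `√S`, normalized by the standard deviations `√(S i i)`. They are the outer unit
normals, in the coordinates `z` with `y = ȳ + √S z`, of the half-spaces `y i ≤ 0`. -/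
noncomputable def unitNormal (S : Matrix (Fin d) (Fin d) ℝ) (i : Fin d) :
    EuclideanSpace ℝ (Fin d) :=
  (√(S i i))⁻¹ • WithLp.toLp 2 (CFC.sqrt S i)

variable {S : Matrix (Fin d) (Fin d) ℝ}

lemma norm_sq_toLp_sqrt_row (hS : S.PosSemidef) (i : Fin d) :
    ‖WithLp.toLp 2 (CFC.sqrt S i)‖ ^ 2 = S i i := by
  have hherm : (CFC.sqrt S).IsHermitian := (CFC.sqrt_nonneg S).isSelfAdjoint
  conv_rhs => rw [← CFC.sqrt_mul_sqrt_self S hS.nonneg]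
  rw [EuclideanSpace.real_norm_sq_eq, Matrix.mul_apply]
  refine Finset.sum_congr rfl fun k _ => ?_
  rw [sq, ← hherm.apply k i]
  simp

lemma norm_unitNormal (hS : S.PosSemidef) {i : Fin d} (hi : 0 < S i i) :
    ‖unitNormal S i‖ = 1 := by
  have hσ : 0 < √(S i i) := Real.sqrt_pos.2 hi
  rw [unitNormal, norm_smul, norm_inv, Real.norm_of_nonneg hσ.le, inv_mul_eq_one₀ hσ.ne',
    ← norm_sq_toLp_sqrt_row hS i, Real.sqrt_sq (norm_nonneg _)]

lemma add_toEuclideanCLM_sqrt_apply_nonpos_iff (ybar z : EuclideanSpace ℝ (Fin d)) {i : Fin d}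
    (hi : 0 < S i i) :
    (ybar + Matrix.toEuclideanCLM (𝕜 := ℝ) (CFC.sqrt S) z) i ≤ 0 ↔
      ⟪unitNormal S i, z⟫ ≤ signedDist ybar S i := by
  have hrow : Matrix.toEuclideanCLM (𝕜 := ℝ) (CFC.sqrt S) z i =
      ⟪WithLp.toLp 2 (CFC.sqrt S i), z⟫ := by
    simp [PiLp.inner_apply, Matrix.mulVec, dotProduct, mul_comm]
  rw [PiLp.add_apply, hrow, unitNormal, real_inner_smul_left, signedDist, inv_mul_eq_div,
    div_le_div_iff_of_pos_right (Real.sqrt_pos.2 hi), le_neg_iff_add_nonpos_left]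

lemma measurableSet_forall_apply_nonpos :
    MeasurableSet {y : EuclideanSpace ℝ (Fin d) | ∀ i, y i ≤ 0} := by
  rw [Set.ofPred_forall]
  exact MeasurableSet.iInter fun i => measurableSet_le (by fun_prop) (by fun_prop)

theorem multivariateGaussian_real_forall_nonpos (ybar : EuclideanSpace ℝ (Fin d))
    (hdiag : ∀ i, 0 < S i i) :
    (multivariateGaussian ybar S).real {y | ∀ i, y i ≤ 0} =
      (stdGaussian _).real (polyhedron (unitNormal S) (signedDist ybar S)) := by
  rw [multivariateGaussian,
    map_measureReal_apply (by fun_prop) measurableSet_forall_apply_nonpos]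
  congr 1
  exact Set.ext fun z => forall_congr' fun i =>
    add_toEuclideanCLM_sqrt_apply_nonpos_iff ybar z (hdiag i)

lemma signedDist_nonneg {ybar : EuclideanSpace ℝ (Fin d)} {i : Fin d} (hi : ybar i ≤ 0) :
    0 ≤ signedDist ybar S i :=
  div_nonneg (neg_nonneg.2 hi) (Real.sqrt_nonneg _)

end Whitening

end FailureRisk

theorem mainTheorem1 {Ω : Type*} [MeasurableSpace Ω] (P : Measure Ω) [IsProbabilityMeasure P]
    (d : ℕ) (hd : 1 ≤ d)
    (ybar : EuclideanSpace ℝ (Fin d)) (S : Matrix (Fin d) (Fin d) ℝ)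
    (hS : S.PosSemidef) (hdiag : ∀ i, 0 < S i i)
    (Y : Ω → EuclideanSpace ℝ (Fin d))
    (hY : HasLaw Y (multivariateGaussian ybar S) P)
    (hybar : ∀ i, ybar i ≤ 0) :
    FailureRisk.realRisk P Y ≤ FailureRisk.betaT (FailureRisk.signedDist ybar S) := by
  rw [FailureRisk.realRisk, hY.measureReal_eq FailureRisk.measurableSet_forall_apply_nonpos,
    FailureRisk.multivariateGaussian_real_forall_nonpos ybar hdiag, sub_le_comm]
  exact FailureRisk.one_sub_betaT_le finrank_euclideanSpace_fin
    (fun i => FailureRisk.norm_unitNormal hS (hdiag i))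
    fun i => FailureRisk.signedDist_nonneg (hybar i)
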